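/- Let $d\ge 1$ and let $\mathbf X=(X_t)_{t\ge 0}$ be a Lévy process in $\mathbb R^d$ with $X_0=0$ almost surely under $\mathbb P$. Let $(A,\gamma,\nu)$ be its Lévy triplet, that is, $A$ is a symmetric non-negative definite $d\times d$ matrix, $\gamma\in\mathbb R^d$, $\nu$ is a Borel measure on $\mathbb R^d$ with $\nu(\{0\})=0$ and $\int\min\{1,|y|^2\}\,\nu(\mathrm dy)<\infty$, and for all $t\ge0$, $\xi\in\mathbb R^d$ one has $\mathbb E\,e^{i\langle\xi,X_t\rangle}=e^{-t\psi(\xi)}$ with $$\psi(\xi)=\langle\xi,A\xi\rangle-i\langle\xi,\gamma\rangle-\int_{\mathbb R^d}\bigl(e^{i\langle\xi,y\rangle}-1-i\langle\xi,y\rangle 1_{\{|y|\le1\}}\bigr)\,\nu(\mathrm dy).$$ Suppose that $\mathbf X$ is of bounded variation, that is, $A=0$ and $\int_{|y|\le1}|y|\,\nu(\mathrm dy)<\infty$, and that its drift $\gamma_0:=\int_{|y|\le1}y\,\nu(\mathrm dy)-\gamma$ is $0$. Let $\Omega\subset\mathbb R^d$ be an open set of finite Lebesgue measure $|\Omega|$,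 and put $$H_\Omega(t)=\int_\Omega\mathbb P(x+X_t\in\Omega)\,\mathrm dx,\qquad \mathrm{Per}_{\mathbf X}(\Omega)=\int_\Omega\nu(\Omega^c-x)\,\mathrm dx\in[0,\infty],\qquad f_\Omega(y)=|\Omega|-|\Omega\cap(\Omega+y)|.$$ Then $$\lim_{t\downarrow0}\frac{|\Omega|-H_\Omega(t)}{t}=\mathrm{Per}_{\mathbf X}(\Omega)=\int_{\mathbb R^d}f_\Omega(y)\,\nu(\mathrm dy),$$ where these quantities may be infinite: if $\mathrm{Per}_{\mathbf X}(\Omega)=\infty$, then the quotient tends to $\infty$. -/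

import Mathlib

open MeasureTheory ProbabilityTheory Filter Topology
open scoped NNReal ENNReal

noncomputable section

namespace LevyHeat

/-- The stochastic process `X`, indexed by the times `t ≥ 0`, is a Lévy process in `ℝ^d` under the
probability measure `P`: it starts at the origin, has independent and stationary increments, is
stochastically continuous and has càdlàg paths almost surely. -/
structure IsLevyProcess {W : Type*} [MeasurableSpace W] (P : Measure W) {d : ℕ}
    (X : ℝ≥0 → W → EuclideanSpace ℝ (Fin d)) : Prop where
  measurable : ∀ t, Measurable (X t)
  start_zero : ∀ᵐ w ∂P, X 0 w = 0
  indep_increments : HasIndepIncrements X P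
  stationary_increments : ∀ s t : ℝ≥0,
    IdentDistrib (fun w => X (s + t) w - X s w) (fun w => X t w - X 0 w) P P
  stochastically_continuous : ∀ t : ℝ≥0, TendstoInMeasure P X (𝓝 t) (X t)
  cadlag : ∀ᵐ w ∂P, ∀ t : ℝ≥0,
    ContinuousWithinAt (fun s => X s w) (Set.Ici t) t ∧
      ∃ l, Tendsto (fun s => X s w) (𝓝[<] t) (𝓝 l)

/-- `ν` is a Lévy measure on `ℝ^d`: `ν({0}) = 0` and `∫ min(1, |y|²) ν(dy) < ∞`. -/
structure IsLevyMeasure {d : ℕ} (ν : Measure (EuclideanSpace ℝ (Fin d))) : Prop where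
  zero_singleton : ν {0} = 0
  lintegral_lt_top : ∫⁻ y, ENNReal.ofReal (min 1 (‖y‖ ^ 2)) ∂ν < ∞

/-- The characteristic exponent with triplet `(A, γ, ν)`:
`ψ(ξ) = ⟨ξ, Aξ⟩ - i⟨ξ, γ⟩ - ∫ (e^{i⟨ξ,y⟩} - 1 - i⟨ξ,y⟩ 1_{|y| ≤ 1}) ν(dy)`. -/
def charExponent {d : ℕ} (A : Matrix (Fin d) (Fin d) ℝ) (γ : EuclideanSpace ℝ (Fin d))
    (ν : Measure (EuclideanSpace ℝ (Fin d))) (ξ : EuclideanSpace ℝ (Fin d)) : ℂ :=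
  ((inner ℝ ξ (Matrix.toEuclideanCLM (𝕜 := ℝ) A ξ) : ℝ) : ℂ)
    - Complex.I * ((inner ℝ ξ γ : ℝ) : ℂ)
    - ∫ y, (Complex.exp (Complex.I * ((inner ℝ ξ y : ℝ) : ℂ)) - 1
        - (Metric.closedBall (0 : EuclideanSpace ℝ (Fin d)) 1).indicator
            (fun z => Complex.I * ((inner ℝ ξ z : ℝ) : ℂ)) y) ∂ν

/-- `(A, γ, ν)` is the Lévy triplet of the process `X`: `A` is symmetric and non-negative definite,
`ν` is a Lévy measure, and `E[e^{i⟨ξ, X_t⟩}] = e^{-t ψ(ξ)}` for all `t ≥ 0` and all `ξ`, where `ψ`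
is the characteristic exponent with triplet `(A, γ, ν)`. -/
structure HasTriplet {W : Type*} [MeasurableSpace W] (P : Measure W) {d : ℕ}
    (X : ℝ≥0 → W → EuclideanSpace ℝ (Fin d)) (A : Matrix (Fin d) (Fin d) ℝ)
    (γ : EuclideanSpace ℝ (Fin d)) (ν : Measure (EuclideanSpace ℝ (Fin d))) : Prop where
  posSemidef : A.PosSemidef
  isLevyMeasure : IsLevyMeasure ν
  charFun_eq : ∀ (t : ℝ≥0) (ξ : EuclideanSpace ℝ (Fin d)),
    charFun (P.map (X t)) ξ = Complex.exp (-((t : ℝ) : ℂ) * charExponent A γ ν ξ)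

/-- Bounded variation of a Lévy process, in terms of its triplet:
`A = 0` and `∫_{|y| ≤ 1} |y| ν(dy) < ∞`. -/
def IsBoundedVariation {d : ℕ} (A : Matrix (Fin d) (Fin d) ℝ)
    (ν : Measure (EuclideanSpace ℝ (Fin d))) : Prop :=
  A = 0 ∧ ∫⁻ y in Metric.closedBall (0 : EuclideanSpace ℝ (Fin d)) 1, ‖y‖ₑ ∂ν < ∞

/-- The drift `γ₀ = ∫_{|y| ≤ 1} y ν(dy) - γ` of a Lévy process of bounded variation. With this sign
the characteristic exponent is `i⟨ξ, γ₀⟩ + ∫ (1 - e^{i⟨ξ,y⟩}) ν(dy)`. -/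
def drift {d : ℕ} (γ : EuclideanSpace ℝ (Fin d)) (ν : Measure (EuclideanSpace ℝ (Fin d))) :
    EuclideanSpace ℝ (Fin d) :=
  (∫ y in Metric.closedBall (0 : EuclideanSpace ℝ (Fin d)) 1, y ∂ν) - γ

/-- The heat content `H_Ω(t) = ∫_Ω P_x(X_t ∈ Ω) dx`, where `P_x(X_t ∈ Ω) = P(x + X_t ∈ Ω)`. -/
def heatContent {W : Type*} [MeasurableSpace W] (P : Measure W) {d : ℕ}
    (X : ℝ≥0 → W → EuclideanSpace ℝ (Fin d)) (Ω : Set (EuclideanSpace ℝ (Fin d))) (t : ℝ≥0) : ℝ :=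
  ∫ x in Ω, P.real {w | x + X t w ∈ Ω}

/-- The perimeter `Per_X(Ω) = ∫_Ω ν(Ω^c - x) dx ∈ [0, ∞]` with respect to a Lévy process with Lévy
measure `ν`. -/
def levyPerimeter {d : ℕ} (ν : Measure (EuclideanSpace ℝ (Fin d)))
    (Ω : Set (EuclideanSpace ℝ (Fin d))) : ℝ≥0∞ :=
  ∫⁻ x in Ω, ν {y | x + y ∈ Ωᶜ}

/-- The covariogram `g_Ω(y) = |Ω ∩ (Ω + y)|`. -/
def covariogram {d : ℕ} (Ω : Set (EuclideanSpace ℝ (Fin d))) (y : EuclideanSpace ℝ (Fin d)) : ℝ :=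
  volume.real (Ω ∩ (fun x => x + y) '' Ω)

/-- `f_Ω(y) = g_Ω(0) - g_Ω(y)`. -/
def covariogramDefect {d : ℕ} (Ω : Set (EuclideanSpace ℝ (Fin d)))
    (y : EuclideanSpace ℝ (Fin d)) : ℝ :=
  covariogram Ω 0 - covariogram Ω y

end LevyHeat

end

/-!
Write `F y = |{x ∈ Ω : x + y ∉ Ω}|`, which is the covariogram defect. By Tonelli, the perimeter is
`∫ F dν` (`levyPerimeter_eq_lintegral`), and `|Ω| - H_Ω(t) = E F(X_t)` by the same computation for
the law of `X_t` (`volume_sub_heatContent`). The function `F` is bounded, continuous, even, vanishes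
at the origin and, above all, is subadditive: `F (x + y) ≤ F x + F y`, since a point leaving `Ω`
under translation by `x + y` leaves it either at the first or at the second step. The theorem is
therefore the statement `E F(X_t) / t → ∫ F dν` for such functions
(`tendsto_lintegral_div_nhdsGT_zero`).

The hypotheses on the triplet say that `X_t` is, in law, the sum of its jumps, with characteristic
exponent `∫ (1 - e^{i⟨ξ, y⟩}) ν(dy)` (`charExponent_eq_neg_integral`). Discarding the jumps of size
at most `1 / (n + 1)` gives compound Poisson laws which converge weakly to the law of `X_t` by
Lévy's theorem (`tendsto_lintegral_compoundPoisson`), so it is enough to estimate compound Poisson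
laws uniformly in the truncation.

* Upper bound. By subadditivity `F` of a sum of jumps is at most the sum of its values at the jumps,
  whose expectation is `∫ F dκ` if `κ` is the jump measure (`lintegral_compoundPoisson_le`). Hence
  `E F(X_t) ≤ t ∫ F dν` for every `t`.
* Lower bound. The jumps larger than `1 / (n + 1)` are independent of the smaller ones. On the
  event that there is exactly one large jump `x` and the small ones add up to `y`, one has
  `F (x + y) ≥ F x - F y` (`exp_neg_mul_lintegral_le_compoundPoisson_add`). The expectation of `F y`
  is small, because `F ≤ ε + C min(1, |·|)` and `min(1, |·|)` is itself subadditive and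
  `ν`-integrable. As `t → 0`, then `ε → 0` and `n → ∞`, this gives `liminf E F(X_t) / t ≥ ∫ F dν`,
  also if the right-hand side is infinite (`exp_neg_mul_lintegral_awayFromZero_le`).
-/

noncomputable section

namespace LevyHeat

open scoped Nat

/-! ### Compound Poisson laws -/

section CompoundPoisson

lemma tsum_ofReal_inv_factorial_mul_pow {α : Type*} [MeasurableSpace α] (κ : Measure α)
    [IsFiniteMeasure κ] :
    ∑' k : ℕ, ENNReal.ofReal (k ! : ℝ)⁻¹ * κ Set.univ ^ k =
      ENNReal.ofReal (Real.exp (κ.real Set.univ)) := by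
  have h := NormedSpace.expSeries_div_hasSum_exp (𝔸 := ℝ) (κ.real Set.univ)
  rw [← Real.exp_eq_exp_ℝ] at h
  rw [← h.tsum_eq, ENNReal.ofReal_tsum_of_nonneg (fun k => by positivity) h.summable]
  refine tsum_congr fun k => ?_
  rw [div_eq_inv_mul, ENNReal.ofReal_mul (by positivity), ENNReal.ofReal_pow measureReal_nonneg,
    ofReal_measureReal]

variable {E : Type*} [NormedAddCommGroup E] [InnerProductSpace ℝ E] [FiniteDimensional ℝ E]
  [MeasurableSpace E] [BorelSpace E]

/-- The `k`-fold convolution power `κ ∗ ⋯ ∗ κ` of a measure, with `δ₀` as power zero. -/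
def convPow (κ : Measure E) : ℕ → Measure E
  | 0 => Measure.dirac 0
  | k + 1 => κ ∗ convPow κ k

instance isFiniteMeasure_convPow (κ : Measure E) [IsFiniteMeasure κ] (k : ℕ) :
    IsFiniteMeasure (convPow κ k) := by
  induction k with
  | zero => exact inferInstanceAs (IsFiniteMeasure (Measure.dirac 0))
  | succ k ih => exact inferInstanceAs (IsFiniteMeasure (κ ∗ convPow κ k))

lemma convPow_univ (κ : Measure E) [IsFiniteMeasure κ] (k : ℕ) :
    convPow κ k Set.univ = κ Set.univ ^ k := by
  induction k with
  | zero => simp [convPow]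
  | succ k ih =>
    rw [convPow, ← lintegral_one, Measure.lintegral_conv measurable_const]
    simp [ih, pow_succ, mul_comm]

lemma charFun_convPow (κ : Measure E) [IsFiniteMeasure κ] (k : ℕ) (ξ : E) :
    charFun (convPow κ k) ξ = charFun κ ξ ^ k := by
  induction k with
  | zero => simp [convPow]
  | succ k ih => rw [convPow, charFun_conv, ih, pow_succ']

/-- The compound Poisson law `e^{-λ} ∑ κ^{∗k} / k!` with finite jump measure `κ` of mass `λ`. -/
def compoundPoisson (κ : Measure E) : Measure E :=
  ENNReal.ofReal (Real.exp (-κ.real Set.univ)) •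
    Measure.sum fun k => ENNReal.ofReal (k ! : ℝ)⁻¹ • convPow κ k

lemma ofReal_exp_neg_mul_ofReal_exp (r : ℝ) :
    ENNReal.ofReal (Real.exp (-r)) * ENNReal.ofReal (Real.exp r) = 1 := by
  rw [← ENNReal.ofReal_mul (by positivity), ← Real.exp_add]
  simp

/-- The total mass before normalization. -/
lemma sum_convPow_univ (κ : Measure E) [IsFiniteMeasure κ] :
    (Measure.sum fun k => ENNReal.ofReal (k ! : ℝ)⁻¹ • convPow κ k) Set.univ =
      ENNReal.ofReal (Real.exp (κ.real Set.univ)) := by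
  rw [Measure.sum_apply _ MeasurableSet.univ, ← tsum_ofReal_inv_factorial_mul_pow κ]
  simp [convPow_univ]

instance isProbabilityMeasure_compoundPoisson (κ : Measure E) [IsFiniteMeasure κ] :
    IsProbabilityMeasure (compoundPoisson κ) where
  measure_univ := by
    rw [compoundPoisson, Measure.smul_apply, sum_convPow_univ, smul_eq_mul,
      ofReal_exp_neg_mul_ofReal_exp]

lemma charFun_compoundPoisson (κ : Measure E) [IsFiniteMeasure κ] (ξ : E) :
    charFun (compoundPoisson κ) ξ =
      Complex.exp (∫ y, (Complex.exp ((inner ℝ y ξ : ℝ) * Complex.I) - 1) ∂κ) := by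
  have hfin : IsFiniteMeasure
      (Measure.sum fun k => ENNReal.ofReal (k ! : ℝ)⁻¹ • convPow κ k) :=
    ⟨by rw [sum_convPow_univ]; exact ENNReal.ofReal_lt_top⟩
  have hint (ρ : Measure E) [IsFiniteMeasure ρ] :
      Integrable (fun y => Complex.exp ((inner ℝ y ξ : ℝ) * Complex.I)) ρ :=
    (integrable_const (1 : ℝ)).mono (by fun_prop) (by simp [Complex.norm_exp_ofReal_mul_I])
  have hsum : HasSum (fun k : ℕ => charFun κ ξ ^ k / (k ! : ℂ))
      (∫ y, Complex.exp ((inner ℝ y ξ : ℝ) * Complex.I)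
        ∂(Measure.sum fun k => ENNReal.ofReal (k ! : ℝ)⁻¹ • convPow κ k)) := by
    refine (hasSum_integral_measure (hint _)).congr_fun fun k => ?_
    rw [integral_smul_measure, ← charFun_apply, charFun_convPow,
      ENNReal.toReal_ofReal (by positivity), Complex.real_smul, div_eq_inv_mul]
    push_cast
    rfl
  have hexp := (NormedSpace.expSeries_div_hasSum_exp (𝔸 := ℂ) (charFun κ ξ))
  rw [← Complex.exp_eq_exp_ℂ] at hexp
  rw [charFun_apply, compoundPoisson, integral_smul_measure, ← hexp.unique hsum,
    integral_sub (hint κ) (integrable_const _), ← charFun_apply, sub_eq_neg_add, Complex.exp_add,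
    ENNReal.toReal_ofReal (by positivity), Complex.real_smul]
  simp

/-- The sum of independent compound Poisson variables is compound Poisson, with the sum of the
jump measures as jump measure. -/
lemma compoundPoisson_add (κ₁ κ₂ : Measure E) [IsFiniteMeasure κ₁] [IsFiniteMeasure κ₂] :
    compoundPoisson (κ₁ + κ₂) = compoundPoisson κ₁ ∗ compoundPoisson κ₂ := by
  refine Measure.ext_of_charFun (funext fun ξ => ?_)
  have hint (ρ : Measure E) [IsFiniteMeasure ρ] :
      Integrable (fun y => Complex.exp ((inner ℝ y ξ : ℝ) * Complex.I) - 1) ρ :=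
    ((integrable_const (1 : ℝ)).mono (by fun_prop)
      (by simp [Complex.norm_exp_ofReal_mul_I])).sub (integrable_const _)
  rw [charFun_conv]
  simp_rw [charFun_compoundPoisson]
  rw [integral_add_measure (hint _) (hint _), Complex.exp_add]

/-- The event of exactly one jump: the law dominates `e^{-λ}` times the jump measure. -/
lemma exp_neg_smul_le_compoundPoisson (κ : Measure E) [IsFiniteMeasure κ] :
    ENNReal.ofReal (Real.exp (-κ.real Set.univ)) • κ ≤ compoundPoisson κ := by
  have h := Measure.le_sum (fun k => ENNReal.ofReal (k ! : ℝ)⁻¹ • convPow κ k) 1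
  have h1 : κ ≤ Measure.sum fun k => ENNReal.ofReal (k ! : ℝ)⁻¹ • convPow κ k := by
    simpa [convPow] using h
  rw [compoundPoisson]
  gcongr

lemma lintegral_convPow_succ_le (κ : Measure E) [IsFiniteMeasure κ] {F : E → ℝ≥0∞}
    (hF : Measurable F) (hadd : ∀ x y, F (x + y) ≤ F x + F y) (k : ℕ) :
    ∫⁻ y, F y ∂(convPow κ (k + 1)) ≤ (k + 1) * (κ Set.univ ^ k * ∫⁻ y, F y ∂κ) := by
  induction k with
  | zero => simp [convPow]
  | succ k ih =>
    rw [convPow, Measure.lintegral_conv hF]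
    calc ∫⁻ x, ∫⁻ y, F (x + y) ∂(convPow κ (k + 1)) ∂κ
        ≤ ∫⁻ x, ∫⁻ y, (F x + F y) ∂(convPow κ (k + 1)) ∂κ := by gcongr; exact hadd _ _
      _ = (∫⁻ x, F x ∂κ) * κ Set.univ ^ (k + 1)
            + (∫⁻ y, F y ∂(convPow κ (k + 1))) * κ Set.univ := by
          simp_rw [lintegral_add_left measurable_const, lintegral_const, convPow_univ]
          rw [lintegral_add_left (hF.mul_const _), lintegral_mul_const _ hF, lintegral_const]
      _ ≤ (∫⁻ x, F x ∂κ) * κ Set.univ ^ (k + 1)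
            + ((k + 1) * (κ Set.univ ^ k * ∫⁻ y, F y ∂κ)) * κ Set.univ := by gcongr
      _ = ((k + 1 : ℕ) + 1) * (κ Set.univ ^ (k + 1) * ∫⁻ y, F y ∂κ) := by
          push_cast
          ring

lemma ofReal_inv_factorial_succ_mul (k : ℕ) :
    ENNReal.ofReal ((k + 1) ! : ℝ)⁻¹ * (k + 1) = ENNReal.ofReal (k ! : ℝ)⁻¹ := by
  have hk : ((k : ℝ≥0∞) + 1) = ENNReal.ofReal (k + 1 : ℝ) := by
    rw [ENNReal.ofReal_add (by positivity) (by positivity)]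
    simp
  rw [hk, ← ENNReal.ofReal_mul (by positivity), Nat.factorial_succ]
  congr 1
  push_cast
  field_simp

/-- A subadditive function of the sum of the jumps is at most the sum of its values at the jumps,
and the expectation of the latter is the integral against the jump measure. -/
lemma lintegral_compoundPoisson_le (κ : Measure E) [IsFiniteMeasure κ] {F : E → ℝ≥0∞}
    (hF : Measurable F) (h0 : F 0 = 0) (hadd : ∀ x y, F (x + y) ≤ F x + F y) :
    ∫⁻ y, F y ∂(compoundPoisson κ) ≤ ∫⁻ y, F y ∂κ := by
  have hterm (k : ℕ) : ENNReal.ofReal ((k + 1) ! : ℝ)⁻¹ * ∫⁻ y, F y ∂(convPow κ (k + 1)) ≤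
      ENNReal.ofReal (k ! : ℝ)⁻¹ * κ Set.univ ^ k * ∫⁻ y, F y ∂κ := by
    grw [lintegral_convPow_succ_le κ hF hadd k, ← ofReal_inv_factorial_succ_mul k]
    exact le_of_eq (by ring)
  have hzero : ∫⁻ y, F y ∂(convPow κ 0) = 0 := by
    rw [convPow, lintegral_dirac' _ hF, h0]
  calc ∫⁻ y, F y ∂(compoundPoisson κ)
      = ENNReal.ofReal (Real.exp (-κ.real Set.univ)) *
          ∑' k : ℕ, ENNReal.ofReal (k ! : ℝ)⁻¹ * ∫⁻ y, F y ∂(convPow κ k) := by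
        rw [compoundPoisson, lintegral_smul_measure, lintegral_sum_measure]
        simp_rw [lintegral_smul_measure, smul_eq_mul]
    _ = ENNReal.ofReal (Real.exp (-κ.real Set.univ)) * ∑' k : ℕ,
          ENNReal.ofReal ((k + 1) ! : ℝ)⁻¹ * ∫⁻ y, F y ∂(convPow κ (k + 1)) := by
        rw [tsum_eq_zero_add' ENNReal.summable, hzero, mul_zero, zero_add]
    _ ≤ ENNReal.ofReal (Real.exp (-κ.real Set.univ)) *
          ∑' k : ℕ, ENNReal.ofReal (k ! : ℝ)⁻¹ * κ Set.univ ^ k * ∫⁻ y, F y ∂κ :=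
        mul_le_mul_right (ENNReal.tsum_le_tsum hterm) _
    _ = ∫⁻ y, F y ∂κ := by
        rw [ENNReal.tsum_mul_right, tsum_ofReal_inv_factorial_mul_pow, ← mul_assoc,
          ofReal_exp_neg_mul_ofReal_exp, one_mul]

/-- Split the jumps into two classes. On the event that exactly one jump `x` of the first class
occurs, the jumps of the second class, of sum `y`, can lower `F` by at most `F y`. -/
lemma exp_neg_mul_lintegral_le_compoundPoisson_add (κ₁ κ₂ : Measure E) [IsFiniteMeasure κ₁]
    [IsFiniteMeasure κ₂] {F : E → ℝ≥0∞} (hF : Measurable F) (hneg : ∀ x, F (-x) = F x)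
    (hadd : ∀ x y, F (x + y) ≤ F x + F y) :
    ENNReal.ofReal (Real.exp (-κ₁.real Set.univ)) * ∫⁻ y, F y ∂κ₁ ≤
      ∫⁻ y, F y ∂(compoundPoisson (κ₁ + κ₂)) +
        κ₁ Set.univ * ∫⁻ y, F y ∂(compoundPoisson κ₂) := by
  set c := ENNReal.ofReal (Real.exp (-κ₁.real Set.univ)) with hc
  have hc1 : c ≤ 1 := by
    rw [hc, ENNReal.ofReal_le_one]
    simp
  have hpt (x y : E) : F x ≤ F (x + y) + F y := by
    simpa [hneg] using hadd (x + y) (-y)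
  have hFadd : Measurable fun p : E × E => F (p.1 + p.2) := by fun_prop
  calc c * ∫⁻ x, F x ∂κ₁
      = c * ∫⁻ x, ∫⁻ _, F x ∂(compoundPoisson κ₂) ∂κ₁ := by simp
    _ ≤ c * ∫⁻ x, ∫⁻ y, (F (x + y) + F y) ∂(compoundPoisson κ₂) ∂κ₁ := by
        gcongr
        exact hpt _ _
    _ = c * ∫⁻ x, ∫⁻ y, F (x + y) ∂(compoundPoisson κ₂) ∂κ₁ +
          c * (κ₁ Set.univ * ∫⁻ y, F y ∂(compoundPoisson κ₂)) := by
        simp_rw [lintegral_add_right _ hF]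
        rw [lintegral_add_right _ measurable_const, lintegral_const, mul_add, mul_comm (κ₁ _)]
    _ ≤ ∫⁻ y, F y ∂(compoundPoisson (κ₁ + κ₂)) +
          κ₁ Set.univ * ∫⁻ y, F y ∂(compoundPoisson κ₂) := by
        gcongr ?_ + ?_
        · rw [compoundPoisson_add, Measure.lintegral_conv hF, ← smul_eq_mul,
            ← lintegral_smul_measure]
          exact lintegral_mono' (exp_neg_smul_le_compoundPoisson κ₁) le_rfl
        · exact mul_le_of_le_one_left' hc1

end CompoundPoisson

/-! ### Approximation by compound Poisson laws -/

section SmallTime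

/-- The complement of the closed ball of radius `1 / (n + 1)`. -/
def awayFromZero (E : Type*) [NormedAddCommGroup E] (n : ℕ) : Set E := {y | ((n : ℝ) + 1)⁻¹ < ‖y‖}

variable {E : Type*} [NormedAddCommGroup E]

lemma monotone_awayFromZero : Monotone (awayFromZero E) := by
  intro n m hnm y (hy : ((n : ℝ) + 1)⁻¹ < ‖y‖)
  refine lt_of_le_of_lt ?_ hy
  gcongr

lemma iUnion_awayFromZero : ⋃ n, awayFromZero E n = {0}ᶜ := by
  ext y
  simp only [awayFromZero, Set.mem_iUnion, Set.mem_ofPred_eq, Set.mem_compl_iff,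
    Set.mem_singleton_iff]
  constructor
  · rintro ⟨n, hn⟩ rfl
    rw [norm_zero] at hn
    exact absurd hn (not_lt.2 (by positivity))
  · intro hy
    obtain ⟨n, hn⟩ := exists_nat_one_div_lt (norm_pos_iff.2 hy)
    exact ⟨n, by simpa using hn⟩

variable [MeasurableSpace E]

lemma restrict_iUnion_awayFromZero {ν : Measure E} (h0 : ν {0} = 0) :
    ν.restrict (⋃ n, awayFromZero E n) = ν := by
  rw [iUnion_awayFromZero]
  exact Measure.restrict_eq_self_of_ae_mem (compl_mem_ae_iff.2 h0)

lemma lintegral_eq_iSup_awayFromZero {ν : Measure E} (h0 : ν {0} = 0) (F : E → ℝ≥0∞) :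
    ∫⁻ y, F y ∂ν = ⨆ n, ∫⁻ y in awayFromZero E n, F y ∂ν := by
  rw [← setLIntegral_iUnion_of_directed _ monotone_awayFromZero.directed_le,
    restrict_iUnion_awayFromZero h0]

variable [BorelSpace E]

lemma measurableSet_awayFromZero (n : ℕ) : MeasurableSet (awayFromZero E n) :=
  (isOpen_lt continuous_const continuous_norm).measurableSet

lemma measure_awayFromZero_lt_top {ν : Measure E}
    (hν : ∫⁻ y, ENNReal.ofReal (min 1 ‖y‖) ∂ν < ∞) (n : ℕ) : ν (awayFromZero E n) < ∞ := by
  have hpos : (0 : ℝ) < ((n : ℝ) + 1)⁻¹ := by positivity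
  have hle : ((n : ℝ) + 1)⁻¹ ≤ 1 := inv_le_one_of_one_le₀ (by simp)
  refine lt_of_le_of_lt (measure_mono fun y (hy : _ < ‖y‖) =>
    ENNReal.ofReal_le_ofReal (le_min hle hy.le)) ?_
  refine (meas_ge_le_lintegral_div (f := fun y : E => ENNReal.ofReal (min 1 ‖y‖)) (by fun_prop)
    (ENNReal.ofReal_pos.2 hpos).ne' ENNReal.ofReal_ne_top).trans_lt ?_
  exact ENNReal.div_lt_top hν.ne (ENNReal.ofReal_pos.2 hpos).ne'

lemma sigmaFinite_of_lintegral_min_lt_top {ν : Measure E} (h0 : ν {0} = 0)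
    (hν : ∫⁻ y, ENNReal.ofReal (min 1 ‖y‖) ∂ν < ∞) : SigmaFinite ν := by
  refine ⟨⟨⟨fun n => awayFromZero E n ∪ {0}, fun _ => trivial, fun n => ?_, ?_⟩⟩⟩
  · exact (measure_union_le _ _).trans_lt (by simpa [h0] using measure_awayFromZero_lt_top hν n)
  · rw [← Set.iUnion_union, iUnion_awayFromZero, Set.compl_union_self]

variable [InnerProductSpace ℝ E]

lemma integrable_exp_inner_sub_one {ν : Measure E}
    (hν : ∫⁻ y, ENNReal.ofReal (min 1 ‖y‖) ∂ν < ∞) (ξ : E) :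
    Integrable (fun y => Complex.exp ((inner ℝ y ξ : ℝ) * Complex.I) - 1) ν := by
  have hmin : Integrable (fun y : E => min 1 ‖y‖) ν := by
    refine ⟨by fun_prop, ?_⟩
    rw [hasFiniteIntegral_iff_ofReal (ae_of_all _ fun y => by positivity)]
    exact hν
  refine (hmin.const_mul (2 + ‖ξ‖)).mono' (by fun_prop) (ae_of_all _ fun y => ?_)
  have h1 : ‖Complex.exp ((inner ℝ y ξ : ℝ) * Complex.I) - 1‖ ≤ 2 := by
    refine (norm_sub_le _ _).trans ?_
    rw [Complex.norm_exp_ofReal_mul_I, norm_one]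
    norm_num
  have h2 : ‖Complex.exp ((inner ℝ y ξ : ℝ) * Complex.I) - 1‖ ≤ ‖y‖ * ‖ξ‖ := by
    rw [mul_comm]
    exact Real.norm_exp_I_mul_ofReal_sub_one_le.trans (norm_inner_le_norm y ξ)
  have hξ := norm_nonneg ξ
  have hy := norm_nonneg y
  rcases min_choice 1 ‖y‖ with h | h <;> rw [h] <;> nlinarith

variable [FiniteDimensional ℝ E]

/-- The law with characteristic function `exp (t ∫ (e^{i⟨y, ξ⟩} - 1) ν(dy))` is the weak limit of
the compound Poisson laws obtained by discarding the jumps of size at most `1 / (n + 1)`. -/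
lemma tendsto_lintegral_compoundPoisson {ν : Measure E} (h0 : ν {0} = 0)
    (hν : ∫⁻ y, ENNReal.ofReal (min 1 ‖y‖) ∂ν < ∞) (t : ℝ≥0) (μ : Measure E)
    [IsProbabilityMeasure μ]
    (hμ : ∀ ξ, charFun μ ξ = Complex.exp
      ((t : ℝ) * ∫ y, (Complex.exp ((inner ℝ y ξ : ℝ) * Complex.I) - 1) ∂ν))
    (f : BoundedContinuousFunction E ℝ≥0) :
    Tendsto (fun n => ∫⁻ y, f y ∂(compoundPoisson (t • ν.restrict (awayFromZero E n))))
      atTop (𝓝 (∫⁻ y, f y ∂μ)) := by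
  have hfin (n : ℕ) : IsFiniteMeasure (ν.restrict (awayFromZero E n)) :=
    ⟨by simpa using measure_awayFromZero_lt_top hν n⟩
  let μs : ℕ → ProbabilityMeasure E := fun n =>
    ⟨compoundPoisson (t • ν.restrict (awayFromZero E n)), inferInstance⟩
  have hconv : Tendsto μs atTop (𝓝 ⟨μ, inferInstance⟩) := by
    refine ProbabilityMeasure.tendsto_of_tendsto_charFun fun ξ => ?_
    simp only [μs, ProbabilityMeasure.coe_mk]
    simp_rw [hμ, charFun_compoundPoisson, integral_smul_nnreal_measure]
    refine (Complex.continuous_exp.tendsto _).comp ?_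
    have h := tendsto_setIntegral_of_monotone (μ := ν) (fun n => measurableSet_awayFromZero n)
      monotone_awayFromZero (integrable_exp_inner_sub_one hν ξ).integrableOn
    rw [restrict_iUnion_awayFromZero h0] at h
    simpa [NNReal.smul_def] using h.const_mul ((t : ℝ) : ℂ)
  exact ProbabilityMeasure.tendsto_iff_forall_lintegral_tendsto.1 hconv f

/-- The upper bound holds for every time, not only in the limit: a subadditive function of a
driftless process of bounded variation is at most the sum of its values at the jumps. -/
lemma lintegral_le_mul_lintegral_levyMeasure {ν : Measure E} (h0 : ν {0} = 0)
    (hν : ∫⁻ y, ENNReal.ofReal (min 1 ‖y‖) ∂ν < ∞) (t : ℝ≥0) (μ : Measure E)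
    [IsProbabilityMeasure μ]
    (hμ : ∀ ξ, charFun μ ξ = Complex.exp
      ((t : ℝ) * ∫ y, (Complex.exp ((inner ℝ y ξ : ℝ) * Complex.I) - 1) ∂ν))
    (f : BoundedContinuousFunction E ℝ≥0) (hf0 : f 0 = 0) (hadd : ∀ x y, f (x + y) ≤ f x + f y) :
    ∫⁻ y, f y ∂μ ≤ t * ∫⁻ y, f y ∂ν := by
  refine le_of_tendsto' (tendsto_lintegral_compoundPoisson h0 hν t μ hμ f) fun n => ?_
  have hfin : IsFiniteMeasure (ν.restrict (awayFromZero E n)) :=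
    ⟨by simpa using measure_awayFromZero_lt_top hν n⟩
  refine (lintegral_compoundPoisson_le _ (by fun_prop) (by simpa using hf0)
    (fun x y => by exact_mod_cast hadd x y)).trans ?_
  rw [lintegral_smul_measure, ENNReal.smul_def, smul_eq_mul]
  gcongr
  exact Measure.restrict_le_self

omit [MeasurableSpace E] [BorelSpace E] [InnerProductSpace ℝ E] [FiniteDimensional ℝ E] in
/-- Continuity at the origin controls `f` near zero, and boundedness controls it elsewhere. -/
lemma exists_le_add_mul_min {f : BoundedContinuousFunction E ℝ≥0} (hf0 : f 0 = 0) {ε : ℝ≥0}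
    (hε : 0 < ε) : ∃ C : ℝ≥0, ∀ y, (f y : ℝ≥0∞) ≤ ε + C * ENNReal.ofReal (min 1 ‖y‖) := by
  have hnear : ∀ᶠ y in 𝓝 (0 : E), f y < ε :=
    f.continuous.continuousAt.eventually_lt continuousAt_const (by rwa [hf0])
  obtain ⟨δ, hδ, hball⟩ := Metric.eventually_nhds_iff.1 hnear
  have hδ' : 0 < min 1 δ := lt_min one_pos hδ
  refine ⟨nndist f 0 / (min 1 δ).toNNReal, fun y => ?_⟩
  rcases lt_or_ge ‖y‖ δ with hy | hy
  · exact (ENNReal.coe_le_coe.2 (hball (by simpa using hy)).le).trans le_self_add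
  · refine le_trans ?_ le_add_self
    have hle : (min 1 δ).toNNReal ≤ (min 1 ‖y‖).toNNReal := by gcongr
    rw [ENNReal.ofReal, ← ENNReal.coe_mul]
    refine ENNReal.coe_le_coe.2 ((BoundedContinuousFunction.NNReal.upper_bound f y).trans ?_)
    calc nndist f 0 = nndist f 0 / (min 1 δ).toNNReal * (min 1 δ).toNNReal :=
          (div_mul_cancel₀ _ (Real.toNNReal_pos.2 hδ').ne').symm
      _ ≤ _ := by gcongr

omit [InnerProductSpace ℝ E] [FiniteDimensional ℝ E] [BorelSpace E] [MeasurableSpace E] in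
lemma ofReal_min_one_norm_add_le (x y : E) : ENNReal.ofReal (min 1 ‖x + y‖) ≤
    ENNReal.ofReal (min 1 ‖x‖) + ENNReal.ofReal (min 1 ‖y‖) := by
  rw [← ENNReal.ofReal_add (by positivity) (by positivity)]
  refine ENNReal.ofReal_le_ofReal ?_
  have h := norm_add_le x y
  have hx := norm_nonneg x
  have hy := norm_nonneg y
  rcases min_choice 1 ‖x‖ with h1 | h1 <;> rcases min_choice 1 ‖y‖ with h2 | h2 <;>
    rw [h1, h2] <;> linarith [min_le_left 1 ‖x + y‖, min_le_right 1 ‖x + y‖]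

/-- The lower bound from the event that the process makes exactly one jump larger than
`1 / (n + 1)` before time `t`. The last summand accounts for the smaller jumps, whose number is
infinite in general; their contribution is small because the function `min 1 ‖y‖` is subadditive and
integrable. -/
lemma exp_neg_mul_lintegral_awayFromZero_le {ν : Measure E} (h0 : ν {0} = 0)
    (hν : ∫⁻ y, ENNReal.ofReal (min 1 ‖y‖) ∂ν < ∞) (t : ℝ≥0) (μ : Measure E)
    [IsProbabilityMeasure μ]
    (hμ : ∀ ξ, charFun μ ξ = Complex.exp
      ((t : ℝ) * ∫ y, (Complex.exp ((inner ℝ y ξ : ℝ) * Complex.I) - 1) ∂ν))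
    (f : BoundedContinuousFunction E ℝ≥0) (hneg : ∀ x, f (-x) = f x)
    (hadd : ∀ x y, f (x + y) ≤ f x + f y) {ε C : ℝ≥0}
    (hC : ∀ y, (f y : ℝ≥0∞) ≤ ε + C * ENNReal.ofReal (min 1 ‖y‖)) (n : ℕ) :
    ENNReal.ofReal (Real.exp (-(t * ν.real (awayFromZero E n)))) *
        (t * ∫⁻ y in awayFromZero E n, f y ∂ν) ≤
      ∫⁻ y, f y ∂μ + t * ν (awayFromZero E n) *
        (ε + C * (t * ∫⁻ y, ENNReal.ofReal (min 1 ‖y‖) ∂ν)) := by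
  refine ge_of_tendsto ((tendsto_lintegral_compoundPoisson h0 hν t μ hμ f).add_const _)
    (eventually_atTop.2 ⟨n, fun m hnm => ?_⟩)
  -- Bound the truncation at level `m ≥ n`, splitting its jumps at the level `n`.
  have hsub := monotone_awayFromZero (E := E) hnm
  have hfin (k : ℕ) : IsFiniteMeasure (ν.restrict (awayFromZero E k)) :=
    ⟨by simpa using measure_awayFromZero_lt_top hν k⟩
  have hfin' : IsFiniteMeasure (ν.restrict (awayFromZero E m \ awayFromZero E n)) :=
    ⟨by simpa using (measure_mono Set.sdiff_subset).trans_lt (measure_awayFromZero_lt_top hν m)⟩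
  have hsplit : t • ν.restrict (awayFromZero E m) = t • ν.restrict (awayFromZero E n) +
      t • ν.restrict (awayFromZero E m \ awayFromZero E n) := by
    rw [← smul_add, ← Measure.restrict_union Set.disjoint_sdiff_right
      ((measurableSet_awayFromZero m).diff (measurableSet_awayFromZero n)),
      Set.union_sdiff_cancel hsub]
  have hsmall : ∫⁻ y, f y ∂(compoundPoisson (t • ν.restrict (awayFromZero E m \ awayFromZero E n)))
      ≤ ε + C * (t * ∫⁻ y, ENNReal.ofReal (min 1 ‖y‖) ∂ν) := by
    refine (lintegral_mono hC).trans ?_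
    rw [lintegral_add_left measurable_const, lintegral_const, measure_univ, mul_one,
      lintegral_const_mul _ (by fun_prop)]
    gcongr
    refine (lintegral_compoundPoisson_le _ (by fun_prop) (by simp)
      ofReal_min_one_norm_add_le).trans ?_
    rw [lintegral_smul_measure, ENNReal.smul_def, smul_eq_mul]
    gcongr
    exact Measure.restrict_le_self
  have h := exp_neg_mul_lintegral_le_compoundPoisson_add (t • ν.restrict (awayFromZero E n))
    (t • ν.restrict (awayFromZero E m \ awayFromZero E n)) (F := fun y => (f y : ℝ≥0∞))
    (by fun_prop) (fun x => by rw [hneg]) (fun x y => by exact_mod_cast hadd x y)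
  have hint : ∫⁻ y, f y ∂(t • ν.restrict (awayFromZero E n)) =
      t * ∫⁻ y in awayFromZero E n, f y ∂ν := by
    rw [lintegral_smul_measure, ENNReal.smul_def, smul_eq_mul]
  have hmass : (t • ν.restrict (awayFromZero E n)) Set.univ = t * ν (awayFromZero E n) := by
    rw [Measure.smul_apply, Measure.restrict_apply_univ, ENNReal.smul_def, smul_eq_mul]
  have hmass' : (t • ν.restrict (awayFromZero E n)).real Set.univ =
      t * ν.real (awayFromZero E n) := by
    rw [measureReal_def, hmass, ENNReal.toReal_mul, ENNReal.coe_toReal, measureReal_def]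
  rw [← hsplit, hint, hmass, hmass'] at h
  refine h.trans ?_
  gcongr

/-- Short-time asymptotics of the expectation of a bounded continuous even subadditive function
vanishing at the origin. The limit may be infinite. -/
theorem tendsto_lintegral_div_nhdsGT_zero {ν : Measure E} (h0 : ν {0} = 0)
    (hν : ∫⁻ y, ENNReal.ofReal (min 1 ‖y‖) ∂ν < ∞) (μ : ℝ≥0 → Measure E)
    [∀ t, IsProbabilityMeasure (μ t)]
    (hμ : ∀ t ξ, charFun (μ t) ξ = Complex.exp
      ((t : ℝ) * ∫ y, (Complex.exp ((inner ℝ y ξ : ℝ) * Complex.I) - 1) ∂ν))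
    (f : BoundedContinuousFunction E ℝ≥0) (hf0 : f 0 = 0) (hneg : ∀ x, f (-x) = f x)
    (hadd : ∀ x y, f (x + y) ≤ f x + f y) :
    Tendsto (fun t : ℝ≥0 => (∫⁻ y, f y ∂(μ t)) / t) (𝓝[>] 0) (𝓝 (∫⁻ y, f y ∂ν)) := by
  refine tendsto_order.2 ⟨fun a ha => ?_, fun b hb => ?_⟩
  · rw [lintegral_eq_iSup_awayFromZero h0] at ha
    obtain ⟨n, hn⟩ := lt_iSup_iff.1 ha
    set L := ∫⁻ y in awayFromZero E n, f y ∂ν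
    set q := ν (awayFromZero E n) with hq
    set K := ∫⁻ y, ENNReal.ofReal (min 1 ‖y‖) ∂ν
    have hqtop : q ≠ ∞ := (measure_awayFromZero_lt_top hν n).ne
    have hLtop : L ≠ ∞ := by
      refine ne_top_of_le_ne_top
        (ENNReal.mul_ne_top (ENNReal.coe_ne_top (r := nndist f 0)) hqtop) ?_
      rw [hq, ← setLIntegral_const]
      exact lintegral_mono fun y =>
        ENNReal.coe_le_coe.2 (BoundedContinuousFunction.NNReal.upper_bound f y)
    have hcoe : Tendsto (fun t : ℝ≥0 => (t : ℝ≥0∞)) (𝓝[>] 0) (𝓝 0) :=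
      (ENNReal.continuous_coe.tendsto 0).mono_left nhdsWithin_le_nhds
    -- `ε` first, since the constant `C` of `f ≤ ε + C min(1, |·|)` depends on it; then `t → 0`.
    obtain ⟨ε, hε, hεpos⟩ : ∃ ε : ℝ≥0, a < L - q * ε ∧ 0 < ε := by
      have hlim : Tendsto (fun ε : ℝ≥0 => L - q * ε) (𝓝[>] 0) (𝓝 (L - q * 0)) :=
        ENNReal.Tendsto.sub tendsto_const_nhds (ENNReal.Tendsto.const_mul hcoe (.inr hqtop))
          (.inl hLtop)
      exact ((hlim.eventually_const_lt (by simpa using hn)).and self_mem_nhdsWithin).exists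
    obtain ⟨C, hC⟩ := exists_le_add_mul_min hf0 hεpos
    have hlim : Tendsto (fun t : ℝ≥0 =>
        ENNReal.ofReal (Real.exp (-(t * ν.real (awayFromZero E n)))) * L - q * (ε + C * (t * K)))
        (𝓝[>] 0) (𝓝 (L - q * ε)) := by
      refine ENNReal.Tendsto.sub ?_ (ENNReal.Tendsto.const_mul ?_ (.inr hqtop)) (.inl hLtop)
      · have hexp : Continuous fun t : ℝ≥0 =>
            ENNReal.ofReal (Real.exp (-(t * ν.real (awayFromZero E n)))) :=
          ENNReal.continuous_ofReal.comp (by fun_prop)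
        simpa using ENNReal.Tendsto.mul_const
          ((hexp.tendsto 0).mono_left nhdsWithin_le_nhds) (.inr hLtop)
      · simpa using (ENNReal.Tendsto.const_mul
          (ENNReal.Tendsto.mul_const hcoe (.inr hν.ne))
            (.inr ENNReal.coe_ne_top)).const_add (ε : ℝ≥0∞)
    filter_upwards [hlim.eventually_const_lt hε, self_mem_nhdsWithin] with t hat ht
    have ht0 : (t : ℝ≥0∞) ≠ 0 := by exact_mod_cast (ne_of_gt ht)
    refine hat.trans_le (tsub_le_iff_right.2 ?_)
    have h := exp_neg_mul_lintegral_awayFromZero_le h0 hν t (μ t) (hμ t) f hneg hadd hC n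
    rw [← ENNReal.mul_le_mul_iff_right ht0 ENNReal.coe_ne_top, mul_add,
      ENNReal.mul_div_cancel ht0 ENNReal.coe_ne_top, mul_left_comm, ← mul_assoc (t : ℝ≥0∞) q]
    exact h
  · filter_upwards [self_mem_nhdsWithin] with t ht
    refine lt_of_le_of_lt (ENNReal.div_le_of_le_mul' ?_) hb
    exact lintegral_le_mul_lintegral_levyMeasure h0 hν t (μ t) (hμ t) f hf0 hadd

end SmallTime

/-! ### The covariogram defect -/

section Covariogram

variable {d : ℕ} {Ω : Set (EuclideanSpace ℝ (Fin d))}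

/-- The set of points of `Ω` that leave `Ω` when translated by `y`. -/
def exitSet (Ω : Set (EuclideanSpace ℝ (Fin d))) (y : EuclideanSpace ℝ (Fin d)) :
    Set (EuclideanSpace ℝ (Fin d)) :=
  {x | x ∈ Ω ∧ x + y ∉ Ω}

lemma volume_exitSet_ne_top (hfin : volume Ω < ∞) (y : EuclideanSpace ℝ (Fin d)) :
    volume (exitSet Ω y) ≠ ∞ :=
  ((measure_mono fun _ hx => hx.1).trans_lt hfin).ne

lemma volume_exitSet_neg (hΩ : MeasurableSet Ω) (hfin : volume Ω < ∞)
    (y : EuclideanSpace ℝ (Fin d)) : volume (exitSet Ω (-y)) = volume (exitSet Ω y) := by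
  have h1 : volume ((fun x => x + y) ⁻¹' (exitSet Ω (-y))) = volume (exitSet Ω (-y)) :=
    measure_preimage_add_right volume y _
  have h2 : volume ((fun x => x + y) ⁻¹' Ω) = volume Ω := measure_preimage_add_right volume y _
  have hpre : (fun x => x + y) ⁻¹' (exitSet Ω (-y)) = (fun x => x + y) ⁻¹' Ω \ Ω := by
    ext x
    simp [exitSet]
  have hex : exitSet Ω y = Ω \ (fun x => x + y) ⁻¹' Ω := rfl
  rw [← h1, hpre, hex]
  exact measure_sdiff_symm ((measurable_add_const y) hΩ).nullMeasurableSet hΩ.nullMeasurableSet h2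
    ((measure_mono Set.inter_subset_right).trans_lt hfin).ne

/-- A point leaving `Ω` under translation by `y + z` leaves it under translation by `y`, or is moved
by `y` to a point of `Ω` leaving it under translation by `z`. -/
lemma volume_exitSet_add_le (y z : EuclideanSpace ℝ (Fin d)) :
    volume (exitSet Ω (y + z)) ≤ volume (exitSet Ω y) + volume (exitSet Ω z) := by
  rw [← measure_preimage_add_right volume y (exitSet Ω z)]
  refine (measure_mono fun x hx => ?_).trans (measure_union_le _ _)
  by_cases hxy : x + y ∈ Ω
  · exact .inr ⟨hxy, by simpa [add_assoc] using hx.2⟩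
  · exact .inl ⟨hx.1, hxy⟩

lemma tendsto_volume_exitSet_nhds_zero (hΩ : MeasurableSet Ω) (hfin : volume Ω < ∞) :
    Tendsto (fun y => volume (exitSet Ω y)) (𝓝 0) (𝓝 0) := by
  -- Translations depend continuously on the shift in the compact-open topology.
  let τ : C(EuclideanSpace ℝ (Fin d), C(EuclideanSpace ℝ (Fin d), EuclideanSpace ℝ (Fin d))) :=
    ContinuousMap.curry ⟨fun p => p.2 + p.1, by fun_prop⟩
  have hpres (y) : MeasurePreserving (τ y) volume volume := measurePreserving_add_right volume y
  have h := tendsto_measure_symmDiff_preimage_nhds_zero (τ.continuous.tendsto 0)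
    (.of_forall hpres) (hpres 0) hΩ.nullMeasurableSet hfin.ne
  refine tendsto_of_tendsto_of_tendsto_of_le_of_le tendsto_const_nhds h (fun _ => zero_le)
    fun y => measure_mono fun x hx => ?_
  exact .inr ⟨by simpa [τ] using hx.1, hx.2⟩

lemma continuous_of_even_subadditive {E : Type*} [SeminormedAddCommGroup E] {f : E → ℝ≥0}
    (hneg : ∀ x, f (-x) = f x) (hadd : ∀ x y, f (x + y) ≤ f x + f y)
    (hlim : Tendsto f (𝓝 0) (𝓝 0)) : Continuous f := by
  refine continuous_iff_continuousAt.2 fun x => tendsto_iff_dist_tendsto_zero.2 ?_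
  have hsub : Tendsto (fun y => ((f (y - x) : ℝ≥0) : ℝ)) (𝓝 x) (𝓝 0) := by
    have h0 : Tendsto (fun y => y - x) (𝓝 x) (𝓝 0) := by
      simpa using (continuous_sub_right x).tendsto x
    have h1 := NNReal.tendsto_coe.2 (hlim.comp h0)
    rwa [NNReal.coe_zero] at h1
  refine squeeze_zero (fun _ => dist_nonneg) (fun y => ?_) hsub
  have h1 : (f y : ℝ) ≤ f (y - x) + f x := by
    have h := hadd (y - x) x
    rw [sub_add_cancel] at h
    exact_mod_cast h
  have h2 : (f x : ℝ) ≤ f (y - x) + f y := by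
    have h := hadd (-(y - x)) y
    rw [hneg, neg_sub, sub_add_cancel] at h
    exact_mod_cast h
  rw [NNReal.dist_eq, abs_le]
  constructor <;> linarith

/-- The volume of the exit set, as a bounded continuous function of the translation. -/
def exitVolume (hΩ : MeasurableSet Ω) (hfin : volume Ω < ∞) :
    BoundedContinuousFunction (EuclideanSpace ℝ (Fin d)) ℝ≥0 :=
  BoundedContinuousFunction.mkOfBound
    ⟨fun y => (volume (exitSet Ω y)).toNNReal, continuous_of_even_subadditive
      (fun y => by rw [volume_exitSet_neg hΩ hfin])
      (fun y z => by
        rw [← ENNReal.toNNReal_add (volume_exitSet_ne_top hfin y) (volume_exitSet_ne_top hfin z)]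
        exact ENNReal.toNNReal_mono (ENNReal.add_ne_top.2
          ⟨volume_exitSet_ne_top hfin y, volume_exitSet_ne_top hfin z⟩) (volume_exitSet_add_le y z))
      ((ENNReal.tendsto_toNNReal ENNReal.zero_ne_top).comp
        (tendsto_volume_exitSet_nhds_zero hΩ hfin))⟩
    (volume Ω).toNNReal fun y z => by
      have hle (y) : (volume (exitSet Ω y)).toNNReal ≤ (volume Ω).toNNReal :=
        ENNReal.toNNReal_mono hfin.ne (measure_mono fun _ hx => hx.1)
      rw [NNReal.dist_eq]
      exact abs_sub_le_of_nonneg_of_le (NNReal.coe_nonneg _) (NNReal.coe_le_coe.2 (hle y))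
        (NNReal.coe_nonneg _) (NNReal.coe_le_coe.2 (hle z))

lemma coe_exitVolume (hΩ : MeasurableSet Ω) (hfin : volume Ω < ∞)
    (y : EuclideanSpace ℝ (Fin d)) : (exitVolume hΩ hfin y : ℝ≥0∞) = volume (exitSet Ω y) :=
  ENNReal.coe_toNNReal (volume_exitSet_ne_top hfin y)

lemma ofReal_covariogramDefect (hΩ : MeasurableSet Ω) (hfin : volume Ω < ∞)
    (y : EuclideanSpace ℝ (Fin d)) :
    ENNReal.ofReal (covariogramDefect Ω y) = volume (exitSet Ω y) := by
  have himage : (fun x => x + y) '' Ω = (fun x => x + -y) ⁻¹' Ω := by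
    simp
  have hex : exitSet Ω (-y) = Ω \ (fun x => x + y) '' Ω := by
    rw [himage]
    rfl
  have hmeas : MeasurableSet ((fun x => x + y) '' Ω) := by
    rw [himage]
    exact measurable_add_const _ hΩ
  have h := measureReal_sdiff_add_inter (μ := volume) (s := Ω) hmeas hfin.ne
  rw [covariogramDefect, covariogram, covariogram]
  simp only [add_zero, Set.image_id', Set.inter_self]
  rw [← h, add_sub_cancel_right, ← hex, ofReal_measureReal (volume_exitSet_ne_top hfin _),
    volume_exitSet_neg hΩ hfin]

/-- Exchanging the integrals over `Ω` and over the jumps. It is used both for the Lévy measure and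
for the law of the process at a fixed time. -/
lemma levyPerimeter_eq_lintegral (hΩ : MeasurableSet Ω)
    (ρ : Measure (EuclideanSpace ℝ (Fin d))) [SFinite ρ] :
    levyPerimeter ρ Ω = ∫⁻ y, volume (exitSet Ω y) ∂ρ := by
  have hT : MeasurableSet {p : EuclideanSpace ℝ (Fin d) × EuclideanSpace ℝ (Fin d) |
      p.1 + p.2 ∈ Ωᶜ} := measurable_add hΩ.compl
  have h := Measure.prod_apply (μ := volume.restrict Ω) (ν := ρ) hT
  rw [Measure.prod_apply_symm hT] at h
  refine h.symm.trans (lintegral_congr fun y => ?_)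
  rw [Measure.restrict_apply (measurable_prodMk_right hT), Set.inter_comm]
  rfl

lemma volume_sub_heatContent {W : Type*} [MeasurableSpace W] (P : Measure W)
    [IsProbabilityMeasure P] (X : ℝ≥0 → W → EuclideanSpace ℝ (Fin d)) (t : ℝ≥0)
    (hX : Measurable (X t)) (hΩ : MeasurableSet Ω) (hfin : volume Ω < ∞) :
    volume.real Ω - heatContent P X Ω t = (levyPerimeter (P.map (X t)) Ω).toReal := by
  have : IsFiniteMeasure (volume.restrict Ω) := ⟨by simpa using hfin⟩
  have hμ : IsProbabilityMeasure (P.map (X t)) := Measure.isProbabilityMeasure_map hX.aemeasurable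
  have hT : MeasurableSet {p : EuclideanSpace ℝ (Fin d) × EuclideanSpace ℝ (Fin d) |
      p.1 + p.2 ∈ Ωᶜ} := measurable_add hΩ.compl
  have hmeas : Measurable fun x => P.map (X t) {y | x + y ∈ Ωᶜ} := measurable_measure_prodMk_left hT
  have hstay (x) : P.real {w | x + X t w ∈ Ω} = 1 - (P.map (X t) {y | x + y ∈ Ωᶜ}).toReal := by
    have hx : MeasurableSet {y | x + y ∈ Ω} := measurable_const_add x hΩ
    have h := probReal_compl_eq_one_sub (μ := P.map (X t)) hx.compl
    rw [compl_compl, map_measureReal_apply hX hx] at h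
    exact h
  have hint : Integrable (fun x => (P.map (X t) {y | x + y ∈ Ωᶜ}).toReal) (volume.restrict Ω) :=
    (integrable_const (1 : ℝ)).mono' hmeas.ennreal_toReal.aestronglyMeasurable
      (ae_of_all _ fun x => by
        rw [Real.norm_of_nonneg ENNReal.toReal_nonneg]
        exact measureReal_le_one)
  rw [heatContent]
  simp_rw [hstay]
  rw [integral_sub (integrable_const _) hint,
    integral_toReal hmeas.aemeasurable (ae_of_all _ fun _ => measure_lt_top _ _)]
  simp [levyPerimeter]

end Covariogram

/-! ### The characteristic exponent in the driftless case of bounded variation -/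

section BoundedVariation

variable {d : ℕ} {A : Matrix (Fin d) (Fin d) ℝ} {γ : EuclideanSpace ℝ (Fin d)}
  {ν : Measure (EuclideanSpace ℝ (Fin d))}

lemma IsLevyMeasure.lintegral_min_one_norm_lt_top (hν : IsLevyMeasure ν)
    (hBV : IsBoundedVariation A ν) : ∫⁻ y, ENNReal.ofReal (min 1 ‖y‖) ∂ν < ∞ := by
  rw [← lintegral_add_compl _ (Metric.isClosed_closedBall (x := (0 : EuclideanSpace ℝ (Fin d)))
    (ε := 1)).measurableSet]
  refine ENNReal.add_lt_top.2 ⟨(lintegral_mono fun y => ?_).trans_lt hBV.2,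
    (setLIntegral_mono' Metric.isClosed_closedBall.measurableSet.compl fun y hy => ?_).trans_lt
      ((setLIntegral_le_lintegral _ _).trans_lt hν.lintegral_lt_top)⟩
  · rw [← ofReal_norm]
    exact ENNReal.ofReal_le_ofReal (min_le_right _ _)
  · have hy' : 1 < ‖y‖ := by simpa using hy
    rw [min_eq_left (by nlinarith : (1 : ℝ) ≤ ‖y‖ ^ 2)]
    exact ENNReal.ofReal_le_ofReal (min_le_left _ _)

/-- Without Gaussian part and without drift the compensator of the small jumps and the linear term
cancel, so that the exponent is the one of a pure jump process. -/
lemma charExponent_eq_neg_integral (hν : IsLevyMeasure ν) (hBV : IsBoundedVariation A ν)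
    (hdrift : drift γ ν = 0) (ξ : EuclideanSpace ℝ (Fin d)) :
    charExponent A γ ν ξ =
      -∫ y, (Complex.exp ((inner ℝ y ξ : ℝ) * Complex.I) - 1) ∂ν := by
  have hball : MeasurableSet (Metric.closedBall (0 : EuclideanSpace ℝ (Fin d)) 1) :=
    Metric.isClosed_closedBall.measurableSet
  have hid : IntegrableOn (fun y => y) (Metric.closedBall (0 : EuclideanSpace ℝ (Fin d)) 1) ν :=
    ⟨by fun_prop, hBV.2⟩
  have hlin : Integrable ((Metric.closedBall (0 : EuclideanSpace ℝ (Fin d)) 1).indicator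
      fun z => Complex.I * ((inner ℝ ξ z : ℝ) : ℂ)) ν :=
    (integrable_indicator_iff hball).2 ((hid.const_inner ξ).ofReal.const_mul Complex.I)
  have hγ : γ = ∫ y in Metric.closedBall (0 : EuclideanSpace ℝ (Fin d)) 1, y ∂ν :=
    (sub_eq_zero.1 hdrift).symm
  have hcomp : ∫ y, (Metric.closedBall (0 : EuclideanSpace ℝ (Fin d)) 1).indicator
      (fun z => Complex.I * ((inner ℝ ξ z : ℝ) : ℂ)) y ∂ν =
        Complex.I * ((inner ℝ ξ γ : ℝ) : ℂ) := by
    rw [integral_indicator hball, integral_const_mul, integral_complex_ofReal, hγ,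
      integral_inner hid]
  have hexp (y) : Complex.exp (Complex.I * ((inner ℝ ξ y : ℝ) : ℂ)) =
      Complex.exp ((inner ℝ y ξ : ℝ) * Complex.I) := by
    rw [mul_comm, real_inner_comm]
  rw [charExponent, hBV.1]
  simp_rw [hexp]
  rw [integral_sub (integrable_exp_inner_sub_one (hν.lintegral_min_one_norm_lt_top hBV) ξ) hlin,
    hcomp]
  simp only [map_zero, zero_apply, inner_zero_right, Complex.ofReal_zero]
  ring

end BoundedVariation

end LevyHeat

end

theorem mainTheorem5 {W : Type*} [MeasurableSpace W] (P : Measure W) [IsProbabilityMeasure P]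
    {d : ℕ} (X : ℝ≥0 → W → EuclideanSpace ℝ (Fin d)) (hX : LevyHeat.IsLevyProcess P X)
    (A : Matrix (Fin d) (Fin d) ℝ) (γ : EuclideanSpace ℝ (Fin d))
    (ν : Measure (EuclideanSpace ℝ (Fin d))) (hT : LevyHeat.HasTriplet P X A γ ν)
    (hBV : LevyHeat.IsBoundedVariation A ν) (hdrift : LevyHeat.drift γ ν = 0)
    (Ω : Set (EuclideanSpace ℝ (Fin d))) (hΩ : IsOpen Ω) (hΩfin : volume Ω < ∞) :
    Tendsto
        (fun t : ℝ≥0 =>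
          (((volume.real Ω - LevyHeat.heatContent P X Ω t) / (t : ℝ) : ℝ) : EReal))
        (𝓝[>] 0) (𝓝 ((LevyHeat.levyPerimeter ν Ω : ℝ≥0∞) : EReal)) ∧
      LevyHeat.levyPerimeter ν Ω =
        ∫⁻ y, ENNReal.ofReal (LevyHeat.covariogramDefect Ω y) ∂ν := by
  have hm := hΩ.measurableSet
  have h0 := hT.isLevyMeasure.zero_singleton
  have hν := hT.isLevyMeasure.lintegral_min_one_norm_lt_top hBV
  have hσ : SigmaFinite ν := LevyHeat.sigmaFinite_of_lintegral_min_lt_top h0 hν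
  have hprob (t) : IsProbabilityMeasure (P.map (X t)) :=
    Measure.isProbabilityMeasure_map (hX.measurable t).aemeasurable
  have hper (ρ : Measure (EuclideanSpace ℝ (Fin d))) [SFinite ρ] :
      LevyHeat.levyPerimeter ρ Ω = ∫⁻ y, LevyHeat.exitVolume hm hΩfin y ∂ρ := by
    simp_rw [LevyHeat.levyPerimeter_eq_lintegral hm, LevyHeat.coe_exitVolume]
  refine ⟨?_, ?_⟩
  · have hlim := LevyHeat.tendsto_lintegral_div_nhdsGT_zero h0 hν (fun t => P.map (X t))
      (fun t ξ => by
        rw [hT.charFun_eq, LevyHeat.charExponent_eq_neg_integral hT.isLevyMeasure hBV hdrift,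
          neg_mul_neg])
      (LevyHeat.exitVolume hm hΩfin)
      (by simp [← ENNReal.coe_eq_zero, LevyHeat.coe_exitVolume, LevyHeat.exitSet])
      (fun y => by
        simp [← ENNReal.coe_inj, LevyHeat.coe_exitVolume, LevyHeat.volume_exitSet_neg hm hΩfin])
      (fun y z => by
        simpa [← ENNReal.coe_le_coe, LevyHeat.coe_exitVolume] using
          LevyHeat.volume_exitSet_add_le y z)
    rw [hper ν]
    refine ((continuous_coe_ennreal_ereal.tendsto _).comp hlim).congr' ?_
    filter_upwards [self_mem_nhdsWithin] with t ht
    have ht0 : (t : ℝ≥0∞) ≠ 0 := by exact_mod_cast ne_of_gt ht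
    have hfin : ∫⁻ y, LevyHeat.exitVolume hm hΩfin y ∂(P.map (X t)) ≠ ∞ :=
      (BoundedContinuousFunction.lintegral_lt_top_of_nnreal _ _).ne
    rw [LevyHeat.volume_sub_heatContent P X t (hX.measurable t) hm hΩfin, hper, Function.comp_apply,
      ← EReal.coe_ennreal_toReal (ENNReal.div_ne_top hfin ht0), ENNReal.toReal_div,
      ENNReal.coe_toReal]
  · rw [LevyHeat.levyPerimeter_eq_lintegral hm]
    simp_rw [LevyHeat.ofReal_covariogramDefect hm hΩfin]
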